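/- Let $\mathbb K$ be an algebraically closed field of characteristic zero and let $H$ be a Hopf algebra over $\mathbb K$ with coproduct $\Delta(h)=h_1\otimes h_2$, counit $\varepsilon$ and antipode $S$. A right $H$-comodule is a $\mathbb K$-vector space $V$ with a linear map $\delta:V\to V\otimes H$ such that $(\mathrm{id}\otimes\varepsilon)\delta=\mathrm{id}$ and $(\delta\otimes\mathrm{id})\delta=(\mathrm{id}\otimes\Delta)\delta$; it is simple if $V\neq 0$ and its only subcomodules are $0$ and $V$. Suppose that $H$ is co-semisimple, i.e. every finite-dimensional right $H$-comodule is a direct sum of simple comodules. Then $H$ possesses a left integral, i.e. a nonzero linear form $\int:H\to\mathbb K$ with $x_1\int(x_2)=\int(x)\,1_H$ for all $x\in H$. Moreover, let $\int$ be any left integral on $H$, and let $\check H$ be the vector space $H$ equipped with the convolution product $$g*f:=\int\bigl(f\,S(g_1)\bigr)\,g_2 .$$ Let $(V_\lambda)_{\lambda\in\Lambda}$ be a family that contains exactly one simple right $H$-comodule from each isomorphism class of simple right $H$-comodules. Then $\check H$ is isomorphic, as a (non-unital) $\mathbb K$-algebra, to the direct sum of the full endomorphism algebras of the simple $H$-comodules: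 $$\check H\;\cong\;\bigoplus_{\lambda\in\Lambda}\mathrm{End}_{\mathbb K}(V_\lambda),$$ where the direct sum consists of the families with finitely many nonzero components, with componentwise operations. -/

import Mathlib

open scoped TensorProduct

universe u v w x

namespace HopfConv

/-- A right coaction of the coalgebra `H` on the vector space `V`: a linear map
`δ : V → V ⊗ H` with `(id ⊗ ε) δ = id` and `(δ ⊗ id) δ = (id ⊗ Δ) δ`. -/
structure RightCoaction (K : Type u) (H : Type v) (V : Type w) [Field K]
    [AddCommGroup H] [Module K H] [Coalgebra K H] [AddCommGroup V] [Module K V] where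
  /-- The structure map `δ`. -/
  coact : V →ₗ[K] V ⊗[K] H
  counit_coact : ∀ y : V,
    TensorProduct.rid K V ((Coalgebra.counit (R := K) (A := H)).lTensor V (coact y)) = y
  coassoc : ∀ y : V,
    TensorProduct.assoc K V H H (coact.rTensor H (coact y)) =
      (Coalgebra.comul (R := K) (A := H)).lTensor V (coact y)

section Comodules

variable {K : Type u} {H : Type v} {V : Type w} {W : Type x} [Field K]
  [AddCommGroup H] [Module K H] [Coalgebra K H]
  [AddCommGroup V] [Module K V] [AddCommGroup W] [Module K W]

/-- `U` is a subcomodule: `δ(U) ⊆ U ⊗ H`, where `U ⊗ H` is seen inside `V ⊗ H`. -/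
def RightCoaction.IsSubcomodule (ρ : RightCoaction K H V) (U : Submodule K V) : Prop :=
  ∀ y ∈ U, ρ.coact y ∈ LinearMap.range (U.subtype.rTensor H)

/-- A simple subcomodule: nonzero, and with no subcomodules besides `0` and itself. -/
def RightCoaction.IsSimpleSubcomodule (ρ : RightCoaction K H V) (U : Submodule K V) : Prop :=
  ρ.IsSubcomodule U ∧ U ≠ ⊥ ∧
    ∀ U' : Submodule K V, U' ≤ U → ρ.IsSubcomodule U' → U' = ⊥ ∨ U' = U

/-- A simple comodule: nonzero, and with no subcomodules besides `0` and itself. -/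
def RightCoaction.IsSimple (ρ : RightCoaction K H V) : Prop :=
  Nontrivial V ∧ ∀ U : Submodule K V, ρ.IsSubcomodule U → U = ⊥ ∨ U = ⊤

/-- The comodule decomposes into an (internal) direct sum of finitely many simple subcomodules. -/
def RightCoaction.IsSumOfSimples (ρ : RightCoaction K H V) : Prop :=
  ∃ (n : ℕ) (U : Fin n → Submodule K V),
    (∀ i, ρ.IsSimpleSubcomodule (U i)) ∧ DirectSum.IsInternal U

/-- Two comodules are isomorphic: there is a linear isomorphism that commutes with the
coactions. -/
def RightCoaction.Iso (ρ : RightCoaction K H V) (σ : RightCoaction K H W) : Prop :=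
  ∃ e : V ≃ₗ[K] W, ∀ y : V, σ.coact (e y) = (e : V →ₗ[K] W).rTensor H (ρ.coact y)

end Comodules

/-- Every finite dimensional right `H`-comodule is a direct sum of simple comodules. (Every finite
dimensional space is isomorphic to one in the universe of `K`.) -/
def IsCosemisimple (K : Type u) (H : Type v) [Field K] [Ring H] [HopfAlgebra K H] : Prop :=
  ∀ (V : Type u) [AddCommGroup V] [Module K V] [FiniteDimensional K V]
    (ρ : RightCoaction K H V), ρ.IsSumOfSimples

section Convolution

variable {K : Type u} {H : Type v} [Field K] [Ring H] [HopfAlgebra K H]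

/-- A left integral: a nonzero linear form `φ` on `H` with `x₁ φ(x₂) = φ(x) 1` for all `x`. -/
def IsLeftIntegral (φ : H →ₗ[K] K) : Prop :=
  φ ≠ 0 ∧ ∀ h : H,
    TensorProduct.rid K H (φ.lTensor H (Coalgebra.comul (R := K) h)) = algebraMap K H (φ h)

/-- The convolution `g * f = φ(f S(g₁)) g₂` with respect to the linear form `φ`. -/
noncomputable def conv (φ : H →ₗ[K] K) (g f : H) : H :=
  TensorProduct.lid K H
    ((φ ∘ₗ LinearMap.mulLeft K f ∘ₗ HopfAlgebra.antipode K).rTensor H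
      (Coalgebra.comul (R := K) g))

theorem conv_add_left (φ : H →ₗ[K] K) (a b c : H) :
    conv φ (a + b) c = conv φ a c + conv φ b c := by
  simp [conv]

theorem conv_zero_left (φ : H →ₗ[K] K) (c : H) : conv φ 0 c = 0 := by
  simp [conv]

theorem conv_add_right (φ : H →ₗ[K] K) (a b c : H) :
    conv φ a (b + c) = conv φ a b + conv φ a c := by
  have h : φ ∘ₗ LinearMap.mulLeft K (b + c) ∘ₗ HopfAlgebra.antipode K =
      φ ∘ₗ LinearMap.mulLeft K b ∘ₗ HopfAlgebra.antipode K +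
        φ ∘ₗ LinearMap.mulLeft K c ∘ₗ HopfAlgebra.antipode K := by
    ext y; simp [add_mul]
  rw [conv, h, LinearMap.rTensor_add]
  simp [conv]

theorem conv_zero_right (φ : H →ₗ[K] K) (a : H) : conv φ a 0 = 0 := by
  have h := conv_add_right φ a 0 0
  rwa [add_zero, left_eq_add] at h

/-- The vector space `H`, equipped with the convolution product of `φ` instead of its own
product. -/
def ConvAlg (_φ : H →ₗ[K] K) : Type v := H

instance (φ : H →ₗ[K] K) : AddCommGroup (ConvAlg φ) := inferInstanceAs (AddCommGroup H)

instance (φ : H →ₗ[K] K) : Module K (ConvAlg φ) := inferInstanceAs (Module K H)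

noncomputable instance (φ : H →ₗ[K] K) : Mul (ConvAlg φ) := ⟨fun g f => conv (H := H) φ g f⟩

noncomputable instance (φ : H →ₗ[K] K) : NonUnitalNonAssocRing (ConvAlg φ) where
  left_distrib a b c := conv_add_right (H := H) φ a b c
  right_distrib a b c := conv_add_left (H := H) φ a b c
  zero_mul a := conv_zero_left (H := H) φ a
  mul_zero a := conv_zero_right (H := H) φ a

end Convolution

/-- The direct sum of the algebras `A i` with componentwise operations: the families in the product
with finite support. It is a non-unital algebra. -/
def directSumAlg (K : Type u) {ι : Type w} (A : ι → Type x) [Field K]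
    [∀ i, Ring (A i)] [∀ i, Algebra K (A i)] : NonUnitalSubalgebra K (∀ i, A i) where
  carrier := {a | {i | a i ≠ 0}.Finite}
  zero_mem' := by simp
  add_mem' {a b} ha hb := (ha.union hb).subset fun i hi => by
    by_contra h
    simp only [Set.mem_union, Set.mem_ofPred_eq, not_or, not_not] at h
    exact hi (by simp [h.1, h.2])
  mul_mem' {a b} ha _ := ha.subset fun i hi h => hi (by simp [h])
  smul_mem' r a ha := ha.subset fun i hi h => hi (by simp [h])

end HopfConv

/-! Let D = H^* with the convolution product. Right comodules are D-modules through α • y = y₀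
α(y₁), and their cyclic submodules are finite dimensional, so co-semisimplicity makes H itself a
semisimple, faithful D-module. Splitting the unit K → H over D gives an integral e with e(1) = 1.
Testing on simple submodules shows that e is two-sided, and every left integral is a nonzero
multiple of it.

The isomorphism factors through D: g ↦ φ(g S(·)) turns the convolution of H into the product of D
(`IsLeftIntegral.integralForm_conv`), and it is injective because φ is two-sided with φ(1) ≠ 0
(`integralForm_injective`). Now let D act on each V_λ. Density separates non-isomorphic simples, so
the matrix coefficients of V_λ reach only the λ-component. They span H, whence finite supports;
forms acting by zero on all V_λ vanish, whence injectivity. By Burnside the coefficient space of V_λ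
has dimension at least dim End(V_λ), so its injection into End(V_λ) is onto
(`IsLeftIntegral.exists_mem_coeffSpace`). -/

namespace HopfConv

open Coalgebra HopfAlgebra WithConv TensorProduct

/-! ### The antipode reverses the coproduct -/

section Antipode

variable {K : Type u} {H : Type v} [Field K] [Ring H] [HopfAlgebra K H]

/-- The antipode is an antimorphism of coalgebras. -/
theorem comul_comp_antipode :
    (comul (R := K) (A := H)) ∘ₗ antipode K =
      TensorProduct.map (antipode K) (antipode K) ∘ₗ
        (TensorProduct.comm K H H).toLinearMap ∘ₗ comul := by
  -- Both sides are convolution inverses of Δ in Hom(H, H ⊗ H): Δ = i₁ * i₂, and the right side is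
  -- (i₂ S) * (i₁ S).
  let i₁ : H →ₐ[K] H ⊗[K] H := Algebra.TensorProduct.includeLeft
  let i₂ : H →ₐ[K] H ⊗[K] H := Algebra.TensorProduct.includeRight
  have hδ : toConv (comul (R := K) (A := H)) =
      toConv i₁.toLinearMap * toConv i₂.toLinearMap := by
    ext h
    rw [(ℛ K h).convMul_apply]
    simp [i₁, i₂, (ℛ K h).eq]
  have hG : toConv (TensorProduct.map (antipode K) (antipode K) ∘ₗ
        (TensorProduct.comm K H H).toLinearMap ∘ₗ comul) =
      toConv (i₂.toLinearMap ∘ₗ antipode K (A := H)) *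
        toConv (i₁.toLinearMap ∘ₗ antipode K) := by
    ext h
    rw [(ℛ K h).convMul_apply]
    simp [i₁, i₂, ← (ℛ K h).eq]
  have hi (i : H →ₐ[K] H ⊗[K] H) :
      toConv (i.toLinearMap ∘ₗ antipode K (A := H)) * toConv i.toLinearMap = 1 := by
    have h := LinearMap.algHom_comp_convMul_distrib i (toConv (antipode K (A := H)))
      (toConv LinearMap.id)
    rw [LinearMap.antipode_mul_id] at h
    apply WithConv.ext
    rw [ofConv_toConv, LinearMap.comp_id] at h
    rw [← h]
    ext; simp
  apply WithConv.toConv_injective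
  symm
  refine left_inv_eq_right_inv (a := toConv (comul (R := K) (A := H))) ?_
    LinearMap.comul_right_inv
  rw [hG, hδ, mul_assoc, ← mul_assoc (toConv (i₁.toLinearMap ∘ₗ _)), hi, one_mul, hi]

theorem comul_antipode (h : H) {ι : Type*} (r : Repr K h ι) :
    comul (R := K) (antipode K h) =
      ∑ i ∈ r.index, antipode K (r.right i) ⊗ₜ[K] antipode K (r.left i) := by
  have := LinearMap.congr_fun (comul_comp_antipode (K := K) (H := H)) h
  simpa [← r.eq] using this

end Antipode

/-! ### Linear forms on H separate the elements of V ⊗ H -/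

section Separation

variable {K : Type u} {H : Type v} {V : Type w} [Field K]
  [AddCommGroup H] [Module K H] [AddCommGroup V] [Module K V]

/-- Evaluation of the second tensor factor at a linear form. -/
noncomputable def evalRight (V : Type w) [AddCommGroup V] [Module K V] (α : H →ₗ[K] K) :
    V ⊗[K] H →ₗ[K] V :=
  (TensorProduct.rid K V).toLinearMap ∘ₗ α.lTensor V

@[simp] theorem evalRight_tmul (α : H →ₗ[K] K) (y : V) (h : H) :
    evalRight V α (y ⊗ₜ h) = α h • y := by
  simp [evalRight]

theorem evalRight_rTensor {W : Type x} [AddCommGroup W] [Module K W] (α : H →ₗ[K] K)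
    (f : V →ₗ[K] W) (t : V ⊗[K] H) :
    evalRight W α (f.rTensor H t) = f (evalRight V α t) := by
  induction t with
  | zero => simp
  | tmul y h => simp
  | add s t hs ht => simp [hs, ht]

theorem eq_zero_of_evalRight (t : V ⊗[K] H) (ht : ∀ α : H →ₗ[K] K, evalRight V α t = 0) :
    t = 0 := by
  let b := Module.Free.chooseBasis K H
  apply (TensorProduct.equivFinsuppOfBasisRight (M := V) b).injective
  ext i
  have := ht (b.coord i)
  rw [map_zero, Finsupp.zero_apply, ← this]
  clear ht this
  induction t with
  | zero => simp
  | tmul y h => simp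
  | add s t hs ht => simp [hs, ht]

theorem eq_of_evalRight {s t : V ⊗[K] H}
    (h : ∀ α : H →ₗ[K] K, evalRight V α s = evalRight V α t) : s = t :=
  sub_eq_zero.mp (eq_zero_of_evalRight _ fun α => by rw [map_sub, h, sub_self])

/-- By exactness, membership means vanishing in (V/U) ⊗ H, which linear forms detect. This turns
subcomodules into D-stable subspaces. -/
theorem mem_range_rTensor_iff (U : Submodule K V) (t : V ⊗[K] H) :
    t ∈ LinearMap.range (U.subtype.rTensor H) ↔ ∀ α : H →ₗ[K] K, evalRight V α t ∈ U := by
  constructor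
  · rintro ⟨s, rfl⟩ α
    rw [evalRight_rTensor]
    exact (evalRight U α s).2
  · intro h
    have hex : Function.Exact (U.subtype.rTensor H) (U.mkQ.rTensor H) :=
      rTensor_exact H (LinearMap.exact_subtype_mkQ U) U.mkQ_surjective
    refine (hex t).mp (eq_zero_of_evalRight _ fun α => ?_)
    rw [evalRight_rTensor]
    simpa using h α

end Separation

/-! ### Translates and the convolution product on the dual -/

section Translation

variable {K : Type u} {H : Type v} [Field K] [AddCommGroup H] [Module K H] [Coalgebra K H]

/-- The left translate `α(g₁) g₂`. -/
noncomputable def leftTranslate (α : H →ₗ[K] K) : H →ₗ[K] H :=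
  (TensorProduct.lid K H).toLinearMap ∘ₗ α.rTensor H ∘ₗ comul

theorem leftTranslate_apply (α : H →ₗ[K] K) (g : H) {ι : Type*} (r : Repr K g ι) :
    leftTranslate α g = ∑ i ∈ r.index, α (r.left i) • r.right i := by
  simp [leftTranslate, ← r.eq]

theorem apply_leftTranslate (α β : WithConv (H →ₗ[K] K)) (g : H) :
    β.ofConv (leftTranslate α.ofConv g) = (α * β).ofConv g := by
  rw [leftTranslate_apply _ g (ℛ K g), (ℛ K g).convMul_apply]
  simp

theorem counit_leftTranslate (α : H →ₗ[K] K) (g : H) :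
    counit (R := K) (leftTranslate α g) = α g := by
  have h := apply_leftTranslate (toConv α) (1 : WithConv (H →ₗ[K] K)) g
  rw [mul_one] at h
  simpa using h

theorem apply_evalRight_comul (α β : WithConv (H →ₗ[K] K)) (g : H) :
    α.ofConv (evalRight H β.ofConv (comul g)) = (α * β).ofConv g := by
  rw [(ℛ K g).convMul_apply]
  simp [← (ℛ K g).eq, mul_comm]

end Translation

/-! ### The map g ↦ φ(g S(·)) from H to its dual algebra -/

section Integral

variable {K : Type u} {H : Type v} [Field K] [Ring H] [HopfAlgebra K H]

/-- The linear form `h ↦ φ(g S(h))`. -/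
noncomputable def integralForm (φ : H →ₗ[K] K) : H →ₗ[K] WithConv (H →ₗ[K] K) where
  toFun g := toConv (φ ∘ₗ LinearMap.mulLeft K g ∘ₗ antipode K)
  map_add' a b := by ext; simp [add_mul]
  map_smul' c a := by ext; simp

@[simp] theorem integralForm_apply (φ : H →ₗ[K] K) (g h : H) :
    (integralForm φ g).ofConv h = φ (g * antipode K h) := rfl

theorem conv_eq_leftTranslate (φ : H →ₗ[K] K) (g f : H) :
    conv φ g f = leftTranslate (integralForm φ f).ofConv g := rfl

/-- `g₁ φ(g₂ S(h)) = φ(g S(h₁)) h₂` for a left integral `φ`. -/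
theorem evalRight_integralForm (φ : H →ₗ[K] K)
    (hφ : ∀ h : H, evalRight H φ (comul h) = algebraMap K H (φ h)) (g h : H) :
    evalRight H (φ ∘ₗ LinearMap.mulRight K (antipode K h)) (comul g) =
      leftTranslate (integralForm φ g).ofConv h := by
  let r := ℛ K g
  let P : H →ₗ[K] H := ∑ i ∈ r.index,
    (integralForm φ (r.right i)).ofConv.smulRight (r.left i)
  let N : H →ₗ[K] H := Algebra.linearMap K H ∘ₗ (integralForm φ g).ofConv
  -- With P(h) = g₁ φ(g₂ S(h)) and N(h) = φ(g S(h)) 1, left integrality at g S(h) reads P * S = N;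
  -- convolving with id cancels S.
  have hN : toConv N = toConv P * toConv (antipode K) := by
    ext h
    rw [(ℛ K h).convMul_apply]
    have h1 := hφ (g * antipode K h)
    rw [Bialgebra.comul_mul, comul_antipode h (ℛ K h), ← r.eq] at h1
    simp only [Finset.sum_mul_sum, Algebra.TensorProduct.tmul_mul_tmul, map_sum,
      evalRight_tmul] at h1
    rw [Finset.sum_comm] at h1
    simp [N, P, ← h1, Finset.sum_mul]
  have hP : toConv P = toConv N * toConv LinearMap.id := by
    rw [hN, mul_assoc, LinearMap.antipode_mul_id, mul_one]
  have h2 := congr($hP h)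
  rw [(ℛ K h).convMul_apply] at h2
  rw [leftTranslate_apply _ h (ℛ K h), ← r.eq]
  simpa [P, N, Algebra.smul_def] using h2

/-- Apply α to `evalRight_integralForm`. Taking for α the form of f gives multiplicativity for the
convolution. -/
theorem integralForm_leftTranslate (φ : H →ₗ[K] K)
    (hφ : ∀ h : H, evalRight H φ (comul h) = algebraMap K H (φ h))
    (α : WithConv (H →ₗ[K] K)) (g : H) :
    integralForm φ (leftTranslate α.ofConv g) = integralForm φ g * α := by
  ext h
  have h1 := congr(α.ofConv $(evalRight_integralForm φ hφ g h))
  rw [apply_leftTranslate] at h1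
  rw [← h1, leftTranslate_apply _ g (ℛ K g), ← (ℛ K g).eq]
  simp [mul_comm]

/-- If `φ` is a right integral and `φ(g S(h)) = 0` for all `h`, then `φ(g₁ S(h)) g₂ = 0`. -/
theorem leftTranslate_eq_zero_of_integralForm (φ : H →ₗ[K] K)
    (hφ : ∀ h : H, leftTranslate φ h = algebraMap K H (φ h)) (g : H)
    (hg : integralForm φ g = 0) (h : H) :
    leftTranslate (φ ∘ₗ LinearMap.mulRight K (antipode K h)) g = 0 := by
  let r := ℛ K g
  -- Right integrality at g S(h) gives φ(g₁ S(h₂)) g₂ S(h₁) = 0. In the opposite algebra this is S *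
  -- P = 0, and there S has the convolution inverse S ∘ S.
  let P : H →ₗ[K] Hᵐᵒᵖ := (MulOpposite.opLinearEquiv K).toLinearMap ∘ₗ ∑ i ∈ r.index,
    (integralForm φ (r.left i)).ofConv.smulRight (r.right i)
  let S : H →ₐ[K] Hᵐᵒᵖ := antipodeAlgHomOp K H
  have hN : toConv S.toLinearMap * toConv P = 0 := by
    ext h
    rw [(ℛ K h).convMul_apply]
    have h1 := hφ (g * antipode K h)
    rw [← integralForm_apply, hg] at h1
    simp only [leftTranslate, LinearMap.comp_apply] at h1
    rw [Bialgebra.comul_mul, comul_antipode h (ℛ K h), ← r.eq] at h1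
    simp only [Finset.sum_mul_sum, Algebra.TensorProduct.tmul_mul_tmul, map_sum,
      LinearMap.rTensor_tmul, LinearEquiv.coe_coe, TensorProduct.lid_tmul] at h1
    rw [Finset.sum_comm] at h1
    apply MulOpposite.unop_injective
    simpa [S, P, Finset.sum_mul] using h1
  have hS : toConv (S.toLinearMap ∘ₗ antipode K) * toConv S.toLinearMap = 1 := by
    have h := LinearMap.algHom_comp_convMul_distrib S (toConv (antipode K (A := H)))
      (toConv LinearMap.id)
    rw [LinearMap.antipode_mul_id] at h
    apply WithConv.ext
    rw [ofConv_toConv, LinearMap.comp_id] at h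
    rw [← h]
    ext; simp
  have hP : toConv P = 0 := by
    rw [← one_mul (toConv P), ← hS, mul_assoc, hN, mul_zero]
  have h2 := congr(MulOpposite.unop ($hP h))
  rw [leftTranslate_apply _ g r]
  simpa [P] using h2

/-- Since φ(g₁ S(·)) ⊗ g₂ = 0, evaluating the first factor at the second gives 0 = φ(g₁ S(g₂)) =
ε(g) φ(1). -/
theorem counit_eq_zero_of_integralForm (φ : H →ₗ[K] K)
    (hφ : ∀ h : H, leftTranslate φ h = algebraMap K H (φ h)) (h1 : φ 1 ≠ 0) (g : H)
    (hg : integralForm φ g = 0) : counit (R := K) g = 0 := by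
  let Θ : H →ₗ[K] (H →ₗ[K] K) := (WithConv.linearEquiv K _).toLinearMap ∘ₗ integralForm φ
  have ht : Θ.rTensor H (comul g) = 0 := by
    refine eq_zero_of_evalRight _ fun α => ?_
    rw [evalRight_rTensor]
    ext h
    have h2 := congr(α $(leftTranslate_eq_zero_of_integralForm φ hφ g hg h))
    rw [leftTranslate_apply _ g (ℛ K g)] at h2
    simp only [← (ℛ K g).eq, map_sum, evalRight_tmul]
    simpa [Θ, mul_comm, Finset.sum_apply] using h2
  have h3 := congr(TensorProduct.lift (LinearMap.id (R := K) (M := H →ₗ[K] K)) $ht)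
  have h4 := congr(φ $(sum_mul_antipode_eq_smul (ℛ K g)))
  rw [← (ℛ K g).eq] at h3
  have h5 : counit (R := K) g * φ 1 = 0 := by
    rw [← smul_eq_mul, ← map_smul, ← h4]
    simpa [Θ] using h3
  exact (mul_eq_zero.mp h5).resolve_right h1

/-- The kernel is stable under left translation and lies in ker ε, while ε of the translates of g
recovers every α(g). -/
theorem integralForm_injective (φ : H →ₗ[K] K)
    (hl : ∀ h : H, evalRight H φ (comul h) = algebraMap K H (φ h))
    (hr : ∀ h : H, leftTranslate φ h = algebraMap K H (φ h)) (h1 : φ 1 ≠ 0) :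
    Function.Injective (integralForm φ) := by
  refine (injective_iff_map_eq_zero _).mpr fun g hg => ?_
  refine (Module.forall_dual_apply_eq_zero_iff K g).mp fun α => ?_
  rw [← counit_leftTranslate]
  refine counit_eq_zero_of_integralForm φ hr h1 _ ?_
  have := integralForm_leftTranslate φ hl (toConv α) g
  rwa [hg, zero_mul] at this

end Integral

/-! ### Comodules as modules over the dual algebra -/

namespace RightCoaction

section Action

variable {K : Type u} {H : Type v} {V : Type w} {W : Type x} [Field K]
  [AddCommGroup H] [Module K H] [Coalgebra K H]
  [AddCommGroup V] [Module K V] [AddCommGroup W] [Module K W]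

theorem evalRight_convMul_coact (ρ : RightCoaction K H V) (α β : WithConv (H →ₗ[K] K)) (y : V) :
    evalRight V (α * β).ofConv (ρ.coact y) =
      evalRight V α.ofConv (ρ.coact (evalRight V β.ofConv (ρ.coact y))) := by
  let F : V ⊗[K] (H ⊗[K] H) →ₗ[K] V := (TensorProduct.rid K V).toLinearMap ∘ₗ
    (LinearMap.mul' K K ∘ₗ TensorProduct.map α.ofConv β.ofConv).lTensor V
  have h1 (t : V ⊗[K] H) : F ((comul (R := K) (A := H)).lTensor V t) =
      evalRight V (α * β).ofConv t := by
    induction t with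
    | zero => simp
    | tmul y h => simp [F]
    | add s t hs ht => simp only [map_add, hs, ht]
  have h2 (t : (V ⊗[K] H) ⊗[K] H) : F (TensorProduct.assoc K V H H t) =
      evalRight V α.ofConv (evalRight (V ⊗[K] H) β.ofConv t) := by
    induction t with
    | zero => simp
    | tmul t h =>
      induction t with
      | zero => simp
      | tmul y g => simp [F, mul_smul, smul_comm (α.ofConv g)]
      | add s t hs ht => simp only [map_add, TensorProduct.add_tmul, hs, ht]
    | add s t hs ht => simp only [map_add, hs, ht]
  rw [← h1, ← ρ.coassoc, h2, evalRight_rTensor]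

/-- The dual algebra of a coalgebra acts on its right comodules by `α • y = y₀ α(y₁)`. -/
noncomputable def action (ρ : RightCoaction K H V) :
    WithConv (H →ₗ[K] K) →ₐ[K] Module.End K V :=
  AlgHom.ofLinearMap
    { toFun := fun α => evalRight V α.ofConv ∘ₗ ρ.coact
      map_add' := fun α β => by ext y; simp [evalRight]
      map_smul' := fun c α => by ext y; simp [evalRight] }
    (by
      ext y
      exact (congrArg (fun f : H →ₗ[K] K => evalRight V f (ρ.coact y)) (by ext; simp)).trans
        (ρ.counit_coact y))
    (fun α β => by ext y; exact ρ.evalRight_convMul_coact α β y)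

theorem action_apply (ρ : RightCoaction K H V) (α : WithConv (H →ₗ[K] K)) (y : V) :
    ρ.action α y = evalRight V α.ofConv (ρ.coact y) := rfl

theorem isSubcomodule_iff (ρ : RightCoaction K H V) (U : Submodule K V) :
    ρ.IsSubcomodule U ↔ ∀ α, ∀ y ∈ U, ρ.action α y ∈ U := by
  simp only [IsSubcomodule, mem_range_rTensor_iff, action_apply]
  exact ⟨fun h α y hy => h y hy _, fun h y hy α => h (toConv α) y hy⟩

theorem coact_eq_rTensor_iff (ρ : RightCoaction K H V) (σ : RightCoaction K H W)
    (f : V →ₗ[K] W) (y : V) :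
    σ.coact (f y) = f.rTensor H (ρ.coact y) ↔ ∀ α, σ.action α (f y) = f (ρ.action α y) := by
  simp only [action_apply, ← evalRight_rTensor]
  exact ⟨fun h α => by rw [h], fun h => eq_of_evalRight fun α => h (toConv α)⟩

/-- Local finiteness: δ(y) is a finite sum of pure tensors, whose first factors span F. -/
theorem exists_finiteDimensional_action_mem (ρ : RightCoaction K H V) (y : V) :
    ∃ F : Submodule K V, FiniteDimensional K F ∧ ∀ α, ρ.action α y ∈ F := by
  have h (t : V ⊗[K] H) : ∃ F : Submodule K V, FiniteDimensional K F ∧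
      ∀ α : H →ₗ[K] K, evalRight V α t ∈ F := by
    induction t with
    | zero => exact ⟨⊥, inferInstance, fun α => by simp⟩
    | tmul y h =>
      exact ⟨K ∙ y, inferInstance, fun α => by
        simpa using Submodule.smul_mem _ _ (Submodule.mem_span_singleton_self y)⟩
    | add s t hs ht =>
      obtain ⟨F, _, hF⟩ := hs
      obtain ⟨G, _, hG⟩ := ht
      exact ⟨F ⊔ G, inferInstance, fun α => by
        simpa using Submodule.add_mem_sup (hF α) (hG α)⟩
  obtain ⟨F, hF, h⟩ := h (ρ.coact y)
  exact ⟨F, hF, fun α => h _⟩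

/-- A space with a coaction, viewed as a module over the dual algebra. -/
def Carrier (_ρ : RightCoaction K H V) : Type w := V

instance (ρ : RightCoaction K H V) : AddCommGroup ρ.Carrier := inferInstanceAs (AddCommGroup V)

instance (ρ : RightCoaction K H V) : Module K ρ.Carrier := inferInstanceAs (Module K V)

noncomputable instance (ρ : RightCoaction K H V) : Module (WithConv (H →ₗ[K] K)) ρ.Carrier :=
  Module.compHom V ρ.action.toRingHom

theorem smul_def (ρ : RightCoaction K H V) (α : WithConv (H →ₗ[K] K)) (y : ρ.Carrier) :
    α • y = (ρ.action α : V → V) y := rfl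

instance (ρ : RightCoaction K H V) : IsScalarTower K (WithConv (H →ₗ[K] K)) ρ.Carrier where
  smul_assoc c α y := by
    rw [smul_def, map_smul, smul_def]
    rfl

/-- A subcomodule as a submodule over the dual algebra. -/
def toSubmodule (ρ : RightCoaction K H V) (U : Submodule K V) (hU : ρ.IsSubcomodule U) :
    Submodule (WithConv (H →ₗ[K] K)) ρ.Carrier where
  carrier := (U : Set V)
  zero_mem' := U.zero_mem
  add_mem' := U.add_mem
  smul_mem' α y hy := (ρ.isSubcomodule_iff U).mp hU α y hy

/-- A submodule over the dual algebra as a subspace. -/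
noncomputable def toSubspace (ρ : RightCoaction K H V) (U : Submodule (WithConv (H →ₗ[K] K)) ρ.Carrier) :
    Submodule K V :=
  U.restrictScalars K

theorem isSubcomodule_toSubspace (ρ : RightCoaction K H V)
    (U : Submodule (WithConv (H →ₗ[K] K)) ρ.Carrier) : ρ.IsSubcomodule (ρ.toSubspace U) :=
  (ρ.isSubcomodule_iff _).mpr fun α _ hy => U.smul_mem α hy

theorem isSimpleModule_carrier_iff (ρ : RightCoaction K H V) :
    IsSimpleModule (WithConv (H →ₗ[K] K)) ρ.Carrier ↔ ρ.IsSimple := by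
  constructor
  · intro h
    refine ⟨IsSimpleModule.nontrivial (WithConv (H →ₗ[K] K)) ρ.Carrier, fun U hU => ?_⟩
    refine (eq_bot_or_eq_top (ρ.toSubmodule U hU)).imp (fun h => ?_) (fun h => ?_)
    · exact SetLike.ext fun z => SetLike.ext_iff.mp h z
    · exact SetLike.ext fun z => SetLike.ext_iff.mp h z
  · rintro ⟨_, h⟩
    have : Nontrivial ρ.Carrier := ‹Nontrivial V›
    refine @IsSimpleModule.mk _ _ _ _ _ (@IsSimpleOrder.mk _ _ _ inferInstance fun U => ?_)
    refine (h _ (ρ.isSubcomodule_toSubspace U)).imp (fun h => ?_) (fun h => ?_)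
    · exact SetLike.ext fun z => SetLike.ext_iff.mp h z
    · exact SetLike.ext fun z => SetLike.ext_iff.mp h z

theorem isAtom_toSubmodule (ρ : RightCoaction K H V) (U : Submodule K V)
    (hU : ρ.IsSimpleSubcomodule U) : IsAtom (ρ.toSubmodule U hU.1) := by
  refine ⟨fun h => hU.2.1 (SetLike.ext fun z => SetLike.ext_iff.mp h z), fun U' hU' => ?_⟩
  refine (hU.2.2 _ (fun z hz => hU'.le hz) (ρ.isSubcomodule_toSubspace U')).elim (fun h => ?_) (fun h => ?_)
  · exact SetLike.ext fun z => SetLike.ext_iff.mp h z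
  · exact absurd (show U' = _ from SetLike.ext fun z => SetLike.ext_iff.mp h z) hU'.ne

theorem IsSumOfSimples.isSemisimpleModule {ρ : RightCoaction K H V} (h : ρ.IsSumOfSimples) :
    IsSemisimpleModule (WithConv (H →ₗ[K] K)) ρ.Carrier := by
  obtain ⟨n, U, hU, hint⟩ := h
  refine isSemisimpleModule_of_isSemisimpleModule_submodule'
    (p := fun i => ρ.toSubmodule (U i) (hU i).1) (fun i => ?_) ?_
  · have := isSimpleModule_iff_isAtom.mpr (ρ.isAtom_toSubmodule (U i) (hU i))
    infer_instance
  · rw [eq_top_iff]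
    intro y _
    have hy : y ∈ ρ.toSubspace (⨆ i, ρ.toSubmodule (U i) (hU i).1) := by
      have h1 : (⨆ i, U i) ≤ ρ.toSubspace (⨆ i, ρ.toSubmodule (U i) (hU i).1) :=
        iSup_le fun i z hz =>
          le_iSup (fun i => ρ.toSubmodule (U i) (hU i).1) i (show z ∈ ρ.toSubmodule _ _ from hz)
      rw [hint.submodule_iSup_eq_top] at h1
      exact h1 Submodule.mem_top
    exact hy

theorem finiteDimensional_span_singleton (ρ : RightCoaction K H V) (y : ρ.Carrier) :
    FiniteDimensional K (ρ.toSubspace (Submodule.span (WithConv (H →ₗ[K] K)) {y})) := by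
  obtain ⟨F, _, hF⟩ := ρ.exists_finiteDimensional_action_mem y
  refine Submodule.finiteDimensional_of_le (S₂ := F) fun z hz => ?_
  have hz' : ∃ α : WithConv (H →ₗ[K] K), α • y = (z : ρ.Carrier) :=
    Submodule.mem_span_singleton.mp hz
  obtain ⟨α, rfl⟩ := hz'
  exact hF α

theorem finiteDimensional_of_isSimpleModule (ρ : RightCoaction K H V)
    (U : Submodule (WithConv (H →ₗ[K] K)) ρ.Carrier)
    (hU : IsSimpleModule (WithConv (H →ₗ[K] K)) U) :
    FiniteDimensional K (ρ.toSubspace U) := by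
  have hat := isSimpleModule_iff_isAtom.mp hU
  obtain ⟨y, hy, hy0⟩ := U.ne_bot_iff.mp hat.1
  have h : Submodule.span (WithConv (H →ₗ[K] K)) {y} = U :=
    (hat.le_iff.mp ((Submodule.span_singleton_le_iff_mem _ _).mpr hy)).resolve_left
      (by simpa using hy0)
  rw [← h]
  exact ρ.finiteDimensional_span_singleton y

theorem IsSimple.finiteDimensional {ρ : RightCoaction K H V} (h : ρ.IsSimple) :
    FiniteDimensional K V := by
  have := ρ.isSimpleModule_carrier_iff.mpr h
  have h1 := ρ.finiteDimensional_of_isSimpleModule ⊤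
    ((Submodule.topEquiv (R := WithConv (H →ₗ[K] K)) (M := ρ.Carrier)).isSimpleModule_iff.mpr this)
  rw [show ρ.toSubspace ⊤ = (⊤ : Submodule K V) from rfl] at h1
  exact Module.Finite.equiv (Submodule.topEquiv (R := K) (M := V))

/-- The coaction induced along a linear embedding whose image is a subcomodule. -/
noncomputable def pullback (ρ : RightCoaction K H V) (i : W →ₗ[K] V) (p : V →ₗ[K] W)
    (hp : p ∘ₗ i = LinearMap.id)
    (h : i.rTensor H ∘ₗ p.rTensor H ∘ₗ ρ.coact ∘ₗ i = ρ.coact ∘ₗ i) : RightCoaction K H W where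
  coact := p.rTensor H ∘ₗ ρ.coact ∘ₗ i
  counit_coact y := by
    change evalRight W counit (p.rTensor H (ρ.coact (i y))) = y
    rw [evalRight_rTensor]
    exact (congrArg p (ρ.counit_coact (i y))).trans (LinearMap.congr_fun hp y)
  coassoc y := by
    -- Coassociativity is checked inside V, because i ⊗ id has the left inverse p ⊗ id.
    have hinj : Function.Injective (i.rTensor (H ⊗[K] H)) := by
      refine Function.LeftInverse.injective (g := p.rTensor (H ⊗[K] H)) fun t => ?_
      rw [← LinearMap.rTensor_comp_apply, hp, LinearMap.rTensor_id, LinearMap.id_apply]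
    have hassoc (t : (W ⊗[K] H) ⊗[K] H) : i.rTensor (H ⊗[K] H) (TensorProduct.assoc K W H H t) =
        TensorProduct.assoc K V H H ((i.rTensor H).rTensor H t) := by
      have : i.rTensor (H ⊗[K] H) ∘ₗ (TensorProduct.assoc K W H H).toLinearMap =
          (TensorProduct.assoc K V H H).toLinearMap ∘ₗ (i.rTensor H).rTensor H := by
        ext; simp
      exact LinearMap.congr_fun this t
    have hcomm (t : W ⊗[K] H) : i.rTensor (H ⊗[K] H) (comul.lTensor W t) =
        (comul (R := K) (A := H)).lTensor V (i.rTensor H t) := by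
      rw [← LinearMap.comp_apply, LinearMap.rTensor_comp_lTensor, ← LinearMap.lTensor_comp_rTensor,
        LinearMap.comp_apply]
    apply hinj
    rw [hassoc, hcomm, ← LinearMap.rTensor_comp_apply, h, LinearMap.rTensor_comp_apply]
    have hy := LinearMap.congr_fun h y
    simp only [LinearMap.comp_apply] at hy ⊢
    rw [hy, ρ.coassoc]

/-- A finite dimensional submodule over the dual algebra is isomorphic to a comodule in the
universe of the base field. -/
theorem exists_linearEquiv_carrier (ρ : RightCoaction K H V)
    (U : Submodule (WithConv (H →ₗ[K] K)) ρ.Carrier) [FiniteDimensional K (ρ.toSubspace U)] :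
    ∃ (n : ℕ) (σ : RightCoaction K H (Fin n → K)),
      Nonempty (σ.Carrier ≃ₗ[WithConv (H →ₗ[K] K)] U) := by
  let e := (Module.finBasis K (ρ.toSubspace U)).equivFun.symm
  let i : (Fin _ → K) →ₗ[K] V := (ρ.toSubspace U).subtype ∘ₗ e.toLinearMap
  have hi : Function.Injective i := (Submodule.injective_subtype _).comp e.injective
  obtain ⟨p, hp⟩ := i.exists_leftInverse_of_injective (LinearMap.ker_eq_bot.mpr hi)
  have h : i.rTensor H ∘ₗ p.rTensor H ∘ₗ ρ.coact ∘ₗ i = ρ.coact ∘ₗ i := by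
    refine LinearMap.ext fun y => ?_
    obtain ⟨t, ht⟩ := ρ.isSubcomodule_toSubspace U (i y) (e y).2
    obtain ⟨s, rfl⟩ : ∃ s, e.toLinearMap.rTensor H s = t :=
      ⟨e.symm.toLinearMap.rTensor H t, by
        rw [← LinearMap.rTensor_comp_apply]; simp⟩
    rw [← LinearMap.rTensor_comp_apply] at ht
    change i.rTensor H (p.rTensor H (ρ.coact (i y))) = ρ.coact (i y)
    rw [← ht]
    change i.rTensor H (p.rTensor H (i.rTensor H s)) = i.rTensor H s
    rw [← LinearMap.rTensor_comp_apply H p i, hp, LinearMap.rTensor_id, LinearMap.id_apply]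
  refine ⟨_, ρ.pullback i p hp h, ⟨{ e with map_smul' := fun α y => Subtype.ext ?_ }⟩⟩
  exact (((ρ.pullback i p hp h).coact_eq_rTensor_iff ρ i y).mp
    (LinearMap.congr_fun h y).symm α).symm

/-- The matrix coefficient `f(y₀) y₁`. -/
noncomputable def coeff (ρ : RightCoaction K H V) (f : Module.Dual K V) : V →ₗ[K] H :=
  (TensorProduct.lid K H).toLinearMap ∘ₗ f.rTensor H ∘ₗ ρ.coact

theorem apply_coeff (ρ : RightCoaction K H V) (f : Module.Dual K V) (y : V)
    (α : WithConv (H →ₗ[K] K)) : α.ofConv (ρ.coeff f y) = f (ρ.action α y) := by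
  rw [action_apply, coeff, LinearMap.comp_apply, LinearMap.comp_apply]
  induction ρ.coact y with
  | zero => simp
  | tmul y h => simp [mul_comm]
  | add s t hs ht => simp only [map_add, hs, ht]

theorem leftTranslate_coeff (ρ : RightCoaction K H V) (f : Module.Dual K V) (y : V)
    (α : WithConv (H →ₗ[K] K)) :
    leftTranslate α.ofConv (ρ.coeff f y) = ρ.coeff (f ∘ₗ ρ.action α) y := by
  refine sub_eq_zero.mp ((Module.forall_dual_apply_eq_zero_iff K _).mp fun β => ?_)
  rw [map_sub, sub_eq_zero]
  exact (apply_leftTranslate α (toConv β) _).trans (by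
    rw [apply_coeff, map_mul, ← ofConv_toConv β, apply_coeff]; rfl)

end Action

end RightCoaction

/-- With no maps between M and N, the projection of M × N onto M commutes with all endomorphisms, so
the density theorem realizes it on finite sets. -/
theorem exists_smul_eq_self_and_smul_eq_zero {D M N : Type*} [Ring D] [AddCommGroup M]
    [Module D M] [AddCommGroup N] [Module D N] [IsSemisimpleModule D M] [IsSemisimpleModule D N]
    (hMN : ∀ f : M →ₗ[D] N, f = 0) (hNM : ∀ f : N →ₗ[D] M, f = 0)
    (s : Finset M) (t : Finset N) :
    ∃ r : D, (∀ m ∈ s, r • m = m) ∧ ∀ n ∈ t, r • n = 0 := by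
  classical
  have : IsSemisimpleModule D (M × N) := by
    have h1 := IsSemisimpleModule.range (LinearMap.inl D M N)
    have h2 := IsSemisimpleModule.range (LinearMap.inr D M N)
    have h3 := IsSemisimpleModule.sup h1 h2
    rw [LinearMap.sup_range_inl_inr] at h3
    exact IsSemisimpleModule.congr (Submodule.topEquiv (R := D) (M := M × N)).symm
  let f : Module.End (Module.End D (M × N)) (M × N) :=
    { toFun := fun m => (m.1, 0)
      map_add' := fun m n => by simp
      map_smul' := fun g m => by
        have h1 : (g (0, m.2)).1 = 0 := LinearMap.congr_fun
          (hNM (LinearMap.fst D M N ∘ₗ g ∘ₗ LinearMap.inr D M N)) m.2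
        have h2 : (g (m.1, 0)).2 = 0 := LinearMap.congr_fun
          (hMN (LinearMap.snd D M N ∘ₗ g ∘ₗ LinearMap.inl D M N)) m.1
        have h3 : g m = g (m.1, 0) + g (0, m.2) := by rw [← map_add]; simp
        change ((g m).1, (0 : N)) = g (m.1, 0)
        rw [h3]
        ext
        · simp [h1]
        · simp [h2] }
  obtain ⟨r, hr⟩ := jacobson_density f
    (s.image (LinearMap.inl D M N) ∪ t.image (LinearMap.inr D M N))
  refine ⟨r, fun m hm => ?_, fun n hn => ?_⟩
  · exact (congrArg Prod.fst (hr _ (Finset.mem_union_left _ (Finset.mem_image_of_mem _ hm)))).symm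
  · exact (congrArg Prod.snd (hr _ (Finset.mem_union_right _ (Finset.mem_image_of_mem _ hn)))).symm

namespace RightCoaction

/-! ### Simple comodules: Schur, Burnside, matrix coefficients -/

section Schur

variable {K : Type u} {H : Type v} {V : Type w} {W : Type x} [Field K]
  [AddCommGroup H] [Module K H] [Coalgebra K H]
  [AddCommGroup V] [Module K V] [AddCommGroup W] [Module K W]

theorem Iso.of_linearEquiv {ρ : RightCoaction K H V} {σ : RightCoaction K H W}
    (e : ρ.Carrier ≃ₗ[WithConv (H →ₗ[K] K)] σ.Carrier) : ρ.Iso σ :=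
  ⟨(e.restrictScalars K : ρ.Carrier ≃ₗ[K] σ.Carrier), fun y =>
    (coact_eq_rTensor_iff ρ σ (e.restrictScalars K : ρ.Carrier ≃ₗ[K] σ.Carrier).toLinearMap y).mpr
      fun α => (e.map_smul α y).symm⟩

theorem Iso.action_eq_zero {ρ : RightCoaction K H V} {σ : RightCoaction K H W} (h : ρ.Iso σ)
    {α : WithConv (H →ₗ[K] K)} (hα : ρ.action α = 0) : σ.action α = 0 := by
  obtain ⟨e, he⟩ := h
  ext y
  have h1 := (coact_eq_rTensor_iff ρ σ e.toLinearMap (e.symm y)).mp (he _) α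
  simpa [hα] using h1

theorem IsSimple.linearMap_eq_zero {ρ : RightCoaction K H V} {σ : RightCoaction K H W}
    (hρ : ρ.IsSimple) (hσ : σ.IsSimple) (h : ¬ ρ.Iso σ)
    (f : ρ.Carrier →ₗ[WithConv (H →ₗ[K] K)] σ.Carrier) : f = 0 := by
  have := ρ.isSimpleModule_carrier_iff.mpr hρ
  have := σ.isSimpleModule_carrier_iff.mpr hσ
  exact f.bijective_or_eq_zero.resolve_left fun hf =>
    h (Iso.of_linearEquiv (LinearEquiv.ofBijective f hf))

/-- Schur's lemma. -/
theorem IsSimple.exists_eq_smul [IsAlgClosed K] {ρ : RightCoaction K H V} (hρ : ρ.IsSimple)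
    (f : Module.End (WithConv (H →ₗ[K] K)) ρ.Carrier) : ∃ c : K, ∀ y, f y = c • y := by
  have := ρ.isSimpleModule_carrier_iff.mpr hρ
  have : FiniteDimensional K ρ.Carrier := hρ.finiteDimensional
  have : Nontrivial ρ.Carrier := hρ.1
  obtain ⟨c, hc⟩ := Module.End.exists_eigenvalue (f.restrictScalars K : Module.End K ρ.Carrier)
  obtain ⟨y, hy⟩ := hc.exists_hasEigenvector
  have hy1 : f y = c • y := hy.apply_eq_smul
  refine ⟨c, fun z => ?_⟩
  rcases LinearMap.injective_or_eq_zero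
    (f - algebraMap K (Module.End (WithConv (H →ₗ[K] K)) ρ.Carrier) c) with h | h
  · refine absurd (h (a₁ := y) (a₂ := 0) ?_) hy.2
    simp [hy1, Module.algebraMap_end_apply]
  · simpa [sub_eq_zero, Module.algebraMap_end_apply] using LinearMap.congr_fun h z

/-- Burnside's theorem. -/
theorem IsSimple.action_surjective [IsAlgClosed K] {ρ : RightCoaction K H V} (hρ : ρ.IsSimple) :
    Function.Surjective ρ.action := by
  classical
  intro T
  have := ρ.isSimpleModule_carrier_iff.mpr hρ
  have := hρ.finiteDimensional
  let b := Module.finBasis K V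
  -- By Schur all D-endomorphisms are scalars, so T commutes with them and density realizes T on a
  -- basis.
  let f : Module.End (Module.End (WithConv (H →ₗ[K] K)) ρ.Carrier) ρ.Carrier :=
    { toFun := T
      map_add' := T.map_add
      map_smul' := fun g y => by
        obtain ⟨c, hc⟩ := hρ.exists_eq_smul g
        exact (congrArg T (hc y)).trans ((T.map_smul c y).trans (hc (T y)).symm) }
  obtain ⟨α, hα⟩ := jacobson_density f (Finset.univ.image b : Finset V)
  exact ⟨α, b.ext fun i => (hα (b i) (Finset.mem_image_of_mem b (Finset.mem_univ i))).symm⟩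

theorem IsSimple.exists_action_eq_one_and_eq_zero {ρ : RightCoaction K H V}
    {σ : RightCoaction K H W} (hρ : ρ.IsSimple) (hσ : σ.IsSimple)
    (h : ¬ ρ.Iso σ) (h' : ¬ σ.Iso ρ) : ∃ α, ρ.action α = 1 ∧ σ.action α = 0 := by
  classical
  have := ρ.isSimpleModule_carrier_iff.mpr hρ
  have := σ.isSimpleModule_carrier_iff.mpr hσ
  have := hρ.finiteDimensional
  have := hσ.finiteDimensional
  let b := Module.finBasis K V
  let c := Module.finBasis K W
  obtain ⟨α, hα, hα'⟩ := exists_smul_eq_self_and_smul_eq_zero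
    (hρ.linearMap_eq_zero hσ h) (hσ.linearMap_eq_zero hρ h')
    (Finset.univ.image b : Finset V) (Finset.univ.image c : Finset W)
  exact ⟨α, b.ext fun i => hα (b i) (Finset.mem_image_of_mem b (Finset.mem_univ i)),
    c.ext fun i => hα' (c i) (Finset.mem_image_of_mem c (Finset.mem_univ i))⟩

/-- The span of the matrix coefficients. -/
noncomputable def coeffSpace (ρ : RightCoaction K H V) : Submodule K H :=
  ⨆ f : Module.Dual K V, LinearMap.range (ρ.coeff f)

theorem coeffSpace_le_iff (ρ : RightCoaction K H V) (U : Submodule K H) :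
    ρ.coeffSpace ≤ U ↔ ∀ f y, ρ.coeff f y ∈ U := by
  simp only [coeffSpace, iSup_le_iff, LinearMap.range_le_iff_comap, Submodule.eq_top_iff',
    Submodule.mem_comap]

theorem action_eq_zero_of_coeffSpace_le_ker (ρ : RightCoaction K H V)
    (α : WithConv (H →ₗ[K] K)) (h : ρ.coeffSpace ≤ LinearMap.ker α.ofConv) : ρ.action α = 0 := by
  ext y
  refine (Module.forall_dual_apply_eq_zero_iff K _).mp fun f => ?_
  rw [← apply_coeff]
  exact (ρ.coeffSpace_le_iff _).mp h f y

/-- A form that kills the coefficients acts by zero. Hence a linear section of D → End(V), followed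
by restriction to the coefficient space, embeds End(V) in its dual. -/
theorem IsSimple.finrank_end_le [IsAlgClosed K] {ρ : RightCoaction K H V} (hρ : ρ.IsSimple)
    [FiniteDimensional K ρ.coeffSpace] :
    Module.finrank K (Module.End K V) ≤ Module.finrank K ρ.coeffSpace := by
  have := hρ.finiteDimensional
  obtain ⟨s, hs⟩ := ρ.action.toLinearMap.exists_rightInverse_of_surjective
    (LinearMap.range_eq_top.mpr hρ.action_surjective)
  let R : WithConv (H →ₗ[K] K) →ₗ[K] Module.Dual K ρ.coeffSpace :=
    ρ.coeffSpace.dualRestrict ∘ₗ (WithConv.linearEquiv K (H →ₗ[K] K)).toLinearMap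
  have hinj : Function.Injective (R ∘ₗ s) := by
    refine (injective_iff_map_eq_zero _).mpr fun T hT => ?_
    rw [← LinearMap.id_apply (R := K) T, ← hs]
    exact ρ.action_eq_zero_of_coeffSpace_le_ker (s T) fun g hg => LinearMap.congr_fun hT ⟨g, hg⟩
  rw [← Subspace.dual_finrank_eq (V := ρ.coeffSpace)]
  exact LinearMap.finrank_le_finrank_of_injective hinj

/-- The coalgebra as a right comodule over itself. -/
noncomputable def regular (K : Type u) (H : Type v) [Field K] [AddCommGroup H] [Module K H]
    [Coalgebra K H] : RightCoaction K H H where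
  coact := comul
  counit_coact h := by simp
  coassoc h := by simp

theorem eq_zero_of_regular_action_eq_zero (α : WithConv (H →ₗ[K] K))
    (h : (regular K H).action α = 0) : α = 0 := by
  ext g
  have h1 := apply_evalRight_comul (1 : WithConv (H →ₗ[K] K)) α g
  rw [one_mul] at h1
  rw [← h1, show evalRight H α.ofConv (comul g) = 0 from LinearMap.congr_fun h g]
  simp

theorem eq_zero_of_smul_simple
    [IsSemisimpleModule (WithConv (H →ₗ[K] K)) (regular K H).Carrier]
    (α : WithConv (H →ₗ[K] K))
    (h : ∀ U : Submodule (WithConv (H →ₗ[K] K)) (regular K H).Carrier,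
      IsSimpleModule (WithConv (H →ₗ[K] K)) U → ∀ y ∈ U, α • y = 0) : α = 0 := by
  refine eq_zero_of_regular_action_eq_zero α (LinearMap.ext fun g => ?_)
  have hg : (g : (regular K H).Carrier) ∈ sSup { U : Submodule (WithConv (H →ₗ[K] K))
      (regular K H).Carrier | IsSimpleModule (WithConv (H →ₗ[K] K)) U } := by
    rw [IsSemisimpleModule.sSup_simples_eq_top]
    trivial
  rw [sSup_eq_iSup'] at hg
  suffices h0 : ∀ z : (regular K H).Carrier, z = g → α • z = 0 from h0 g rfl
  rintro z rfl
  induction hg using Submodule.iSup_induction' with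
  | mem U y hy => exact h U.1 U.2 y hy
  | zero => exact smul_zero α
  | add y z _ _ hy hz => rw [smul_add, hy, hz, add_zero]

end Schur

/-! ### Co-semisimplicity and the existence of an integral -/

section Cosemisimple

variable {K : Type u} {H : Type v} [Field K] [Ring H] [HopfAlgebra K H]

theorem _root_.HopfConv.IsCosemisimple.isSemisimpleModule_regular (hH : IsCosemisimple K H) :
    IsSemisimpleModule (WithConv (H →ₗ[K] K)) (regular K H).Carrier := by
  refine isSemisimpleModule_of_isSemisimpleModule_submodule'
    (p := fun h : (regular K H).Carrier => Submodule.span (WithConv (H →ₗ[K] K)) {h})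
    (fun h => ?_) (eq_top_iff.mpr fun h _ => ?_)
  · have := (regular K H).finiteDimensional_span_singleton h
    obtain ⟨n, σ, ⟨e⟩⟩ := (regular K H).exists_linearEquiv_carrier
      (Submodule.span (WithConv (H →ₗ[K] K)) {h})
    have := (hH _ σ).isSemisimpleModule
    exact IsSemisimpleModule.congr e.symm
  · exact Submodule.mem_iSup_of_mem h (Submodule.mem_span_singleton_self h)

/-- A linear form that acts by zero on every simple comodule is zero. -/
theorem _root_.HopfConv.IsCosemisimple.eq_zero_of_action_eq_zero (hH : IsCosemisimple K H)
    (α : WithConv (H →ₗ[K] K))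
    (h : ∀ (W : Type u) [AddCommGroup W] [Module K W] (σ : RightCoaction K H W),
      σ.IsSimple → σ.action α = 0) : α = 0 := by
  have := hH.isSemisimpleModule_regular
  refine eq_zero_of_smul_simple α fun U hU y hy => ?_
  have := (regular K H).finiteDimensional_of_isSimpleModule U hU
  obtain ⟨n, σ, ⟨e⟩⟩ := (regular K H).exists_linearEquiv_carrier U
  have hσ : σ.IsSimple := σ.isSimpleModule_carrier_iff.mp (e.isSimpleModule_iff.mpr hU)
  have h1 : α • e.symm ⟨y, hy⟩ = 0 := LinearMap.congr_fun (h _ σ hσ) _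
  rw [← map_smul, map_eq_zero_iff _ e.symm.injective] at h1
  exact congrArg Subtype.val h1

/-- The one-dimensional comodule given by the unit of `H`. -/
noncomputable def unit (K : Type u) (H : Type v) [Field K] [Ring H] [HopfAlgebra K H] :
    RightCoaction K H K where
  coact := (TensorProduct.mk K K H).flip 1
  counit_coact c := by simp
  coassoc c := by simp [Algebra.TensorProduct.one_def]

/-- The embedding of the one-dimensional unit comodule in `H`. -/
noncomputable def unitEmbedding (K : Type u) (H : Type v) [Field K] [Ring H] [HopfAlgebra K H] :
    (unit K H).Carrier →ₗ[WithConv (H →ₗ[K] K)] (regular K H).Carrier where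
  toFun := algebraMap K H
  map_add' := map_add (algebraMap K H)
  map_smul' α c := by
    refine ((coact_eq_rTensor_iff (unit K H) (regular K H) (Algebra.linearMap K H) c).mp
      ?_ α).symm
    have h (c : K) : comul (R := K) (algebraMap K H c) =
        (Algebra.linearMap K H).rTensor H (c ⊗ₜ[K] (1 : H)) := by simp
    exact h c

/-- The form e is a D-linear retraction of the unit K → H; its linearity, e(h₁ α(h₂)) = α(1) e(h),
is the integral identity. -/
theorem _root_.HopfConv.IsCosemisimple.exists_right_integral (hH : IsCosemisimple K H) :
    ∃ e : WithConv (H →ₗ[K] K), e.ofConv 1 = 1 ∧ ∀ α, e * α = α.ofConv 1 • e := by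
  have := hH.isSemisimpleModule_regular
  obtain ⟨p, hp⟩ := IsSemisimpleModule.extension_property (unitEmbedding K H)
    (Function.LeftInverse.injective (g := counit (R := K) (A := H)) (f := algebraMap K H)
      Bialgebra.counit_algebraMap) LinearMap.id
  let e : H →ₗ[K] K := (p.restrictScalars K : (regular K H).Carrier →ₗ[K] (unit K H).Carrier)
  refine ⟨toConv e, ?_, fun α => ?_⟩
  · have h1 : p (algebraMap K H 1) = (1 : K) := LinearMap.congr_fun hp (1 : K)
    rwa [map_one] at h1
  · ext h
    rw [← apply_evalRight_comul]
    refine (p.map_smul α h).trans ?_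
    change evalRight K α.ofConv ((TensorProduct.mk K K H).flip 1 (e h)) = _
    simp

end Cosemisimple

end RightCoaction

/-! ### Integrals are two-sided and unique up to scalar -/

section TwoSided

open RightCoaction

variable {K : Type u} {H : Type v} [Field K] [Ring H] [HopfAlgebra K H]

/-- The annihilator N of e in M is a submodule and contains α e y − α(1) e y. Simplicity leaves N =
0, which gives the claim, or N = M, where e y = 0. -/
theorem mul_right_integral_smul {M : Type w} [AddCommGroup M] [Module (WithConv (H →ₗ[K] K)) M]
    [IsSimpleModule (WithConv (H →ₗ[K] K)) M] (e : WithConv (H →ₗ[K] K))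
    (he : ∀ α, e * α = α.ofConv 1 • e) (α : WithConv (H →ₗ[K] K)) (y : M) :
    (α * e) • y = (α.ofConv 1 • e) • y := by
  let N : Submodule (WithConv (H →ₗ[K] K)) M :=
    { carrier := {z | e • z = 0}
      zero_mem' := smul_zero e
      add_mem' := fun {a b} ha hb => by
        rw [Set.mem_ofPred_eq] at *
        rw [smul_add, ha, hb, add_zero]
      smul_mem' := fun β z hz => by
        rw [Set.mem_ofPred_eq] at *
        rw [← mul_smul, he, ← one_mul e, ← smul_mul_assoc, mul_smul, hz, smul_zero] }
  have hN (z : M) : z ∈ N ↔ e • z = 0 := Iff.rfl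
  have key : α • e • y - (α.ofConv 1 • (1 : WithConv (H →ₗ[K] K))) • e • y ∈ N := by
    rw [hN, smul_sub, ← mul_smul, ← mul_smul e, he, mul_smul_comm, mul_one, sub_self]
  have goal : α • e • y - (α.ofConv 1 • (1 : WithConv (H →ₗ[K] K))) • e • y = 0 := by
    rcases eq_bot_or_eq_top N with h | h
    · rwa [h, Submodule.mem_bot] at key
    · have hy : e • y = 0 := (hN y).mp (h ▸ Submodule.mem_top)
      rw [hy, smul_zero, smul_zero, sub_zero]
  rw [sub_eq_zero, ← mul_smul, ← mul_smul, smul_mul_assoc, one_mul] at goal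
  exact goal

theorem IsCosemisimple.exists_integral (hH : IsCosemisimple K H) :
    ∃ e : WithConv (H →ₗ[K] K), e.ofConv 1 = 1 ∧ (∀ α, e * α = α.ofConv 1 • e) ∧
      ∀ α, α * e = α.ofConv 1 • e := by
  obtain ⟨e, he1, he⟩ := hH.exists_right_integral
  have := hH.isSemisimpleModule_regular
  refine ⟨e, he1, he, fun α => sub_eq_zero.mp (eq_zero_of_smul_simple _ fun U hU y hy => ?_)⟩
  have h := mul_right_integral_smul e he α (⟨y, hy⟩ : U)
  rw [sub_smul, sub_eq_zero]
  exact congrArg Subtype.val h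

theorem evalRight_comul_eq_algebraMap_iff (φ : WithConv (H →ₗ[K] K)) :
    (∀ h : H, evalRight H φ.ofConv (comul h) = algebraMap K H (φ.ofConv h)) ↔
      ∀ α, α * φ = α.ofConv 1 • φ := by
  constructor
  · intro h α
    ext g
    rw [← apply_evalRight_comul, h]
    simp [Algebra.algebraMap_eq_smul_one, mul_comm]
  · intro h g
    refine sub_eq_zero.mp ((Module.forall_dual_apply_eq_zero_iff K _).mp fun α => ?_)
    rw [map_sub, sub_eq_zero]
    refine (apply_evalRight_comul (toConv α) φ g).trans ?_
    rw [h]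
    simp [Algebra.algebraMap_eq_smul_one, mul_comm]

theorem leftTranslate_eq_algebraMap (φ : WithConv (H →ₗ[K] K))
    (h : ∀ α, φ * α = α.ofConv 1 • φ) (g : H) :
    leftTranslate φ.ofConv g = algebraMap K H (φ.ofConv g) := by
  refine sub_eq_zero.mp ((Module.forall_dual_apply_eq_zero_iff K _).mp fun α => ?_)
  rw [map_sub, sub_eq_zero]
  refine (apply_leftTranslate φ (toConv α) g).trans ?_
  rw [h]
  simp [Algebra.algebraMap_eq_smul_one, mul_comm]

theorem isLeftIntegral_iff (φ : WithConv (H →ₗ[K] K)) :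
    IsLeftIntegral φ.ofConv ↔ φ ≠ 0 ∧ ∀ α, α * φ = α.ofConv 1 • φ := by
  rw [← evalRight_comul_eq_algebraMap_iff, ← ofConv_eq_zero.ne]
  rfl

theorem IsCosemisimple.exists_isLeftIntegral (hH : IsCosemisimple K H) :
    ∃ φ : H →ₗ[K] K, IsLeftIntegral φ := by
  obtain ⟨e, he1, -, he⟩ := hH.exists_integral
  refine ⟨e.ofConv, (isLeftIntegral_iff e).mpr ⟨?_, he⟩⟩
  rintro rfl
  simp at he1

theorem IsLeftIntegral.apply_one_ne_zero {φ : H →ₗ[K] K} (hφ : IsLeftIntegral φ)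
    (hH : IsCosemisimple K H) :
    φ 1 ≠ 0 ∧ ∀ h : H, leftTranslate φ h = algebraMap K H (φ h) := by
  obtain ⟨e, he1, her, hel⟩ := hH.exists_integral
  obtain ⟨h0, hl⟩ := (isLeftIntegral_iff (toConv φ)).mp hφ
  -- Compute e * φ twice: it is φ by left integrality of φ, and φ(1) e by right integrality of e.
  have h1 : toConv φ = φ 1 • e := by
    have := hl e
    rwa [her, he1, one_smul, eq_comm] at this
  refine ⟨fun h => h0 (by rw [h1, h, zero_smul]), leftTranslate_eq_algebraMap (toConv φ) ?_⟩
  intro α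
  rw [h1, smul_mul_assoc, her, smul_comm]

theorem IsLeftIntegral.integralForm_injective {φ : H →ₗ[K] K} (hφ : IsLeftIntegral φ)
    (hH : IsCosemisimple K H) : Function.Injective (integralForm φ) :=
  HopfConv.integralForm_injective φ hφ.2 (hφ.apply_one_ne_zero hH).2 (hφ.apply_one_ne_zero hH).1

theorem IsLeftIntegral.integralForm_conv {φ : H →ₗ[K] K} (hφ : IsLeftIntegral φ) (g f : H) :
    integralForm φ (conv φ g f) = integralForm φ g * integralForm φ f := by
  rw [conv_eq_leftTranslate, integralForm_leftTranslate φ hφ.2]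

end TwoSided

/-! ### Peter–Weyl decomposition and its image in the End(V_λ) -/

section Decomposition

variable {K : Type u} {H : Type v} [Field K] [Ring H] [HopfAlgebra K H]
  {Λ : Type w} {V : Λ → Type x} [∀ i, AddCommGroup (V i)] [∀ i, Module K (V i)]
  {ρ : ∀ i, RightCoaction K H (V i)}

theorem IsCosemisimple.eq_zero_of_forall_action_eq_zero (hH : IsCosemisimple K H)
    (hcov : ∀ (W : Type u) [AddCommGroup W] [Module K W] (σ : RightCoaction K H W),
      σ.IsSimple → ∃ i, (ρ i).Iso σ)
    (α : WithConv (H →ₗ[K] K)) (h : ∀ i, (ρ i).action α = 0) : α = 0 :=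
  hH.eq_zero_of_action_eq_zero α fun W _ _ σ hσ =>
    let ⟨i, hi⟩ := hcov W σ hσ
    hi.action_eq_zero (h i)

/-- The Peter–Weyl theorem: the matrix coefficients of the simple comodules span `H`. -/
theorem IsCosemisimple.iSup_coeffSpace (hH : IsCosemisimple K H)
    (hcov : ∀ (W : Type u) [AddCommGroup W] [Module K W] (σ : RightCoaction K H W),
      σ.IsSimple → ∃ i, (ρ i).Iso σ) : ⨆ i, (ρ i).coeffSpace = ⊤ := by
  by_contra hne
  obtain ⟨α, hα0, hα⟩ := Submodule.exists_le_ker_of_lt_top _ (lt_top_iff_ne_top.mpr hne)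
  refine hα0 (toConv_eq_zero.mp (hH.eq_zero_of_forall_action_eq_zero hcov (toConv α) fun i => ?_))
  exact (ρ i).action_eq_zero_of_coeffSpace_le_ker _ ((le_iSup _ i).trans hα)

/-- Choose α acting as 1 on V_i and 0 on V_j. Translation by α fixes the coefficients of V_i, so
their forms have α as a right factor. -/
theorem IsLeftIntegral.action_integralForm_eq_zero {φ : H →ₗ[K] K} (hφ : IsLeftIntegral φ)
    (hsimple : ∀ i, (ρ i).IsSimple) (hinj : ∀ i j, (ρ i).Iso (ρ j) → i = j)
    {i j : Λ} (hij : i ≠ j) {g : H} (hg : g ∈ (ρ i).coeffSpace) :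
    (ρ j).action (integralForm φ g) = 0 := by
  obtain ⟨α, hα1, hα0⟩ := (hsimple i).exists_action_eq_one_and_eq_zero (hsimple j)
    (fun h => hij (hinj _ _ h)) (fun h => hij (hinj _ _ h).symm)
  suffices h : (ρ i).coeffSpace ≤
      LinearMap.ker ((ρ j).action.toLinearMap ∘ₗ integralForm φ) from h hg
  refine ((ρ i).coeffSpace_le_iff _).mpr fun f y => ?_
  have h : (ρ i).coeff f y = leftTranslate α.ofConv ((ρ i).coeff f y) := by
    rw [RightCoaction.leftTranslate_coeff, hα1]
    rfl
  rw [LinearMap.mem_ker, h, LinearMap.comp_apply, integralForm_leftTranslate φ hφ.2]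
  simp [hα0]

theorem IsLeftIntegral.finite_setOf_action_integralForm_ne_zero {φ : H →ₗ[K] K}
    (hφ : IsLeftIntegral φ) (hH : IsCosemisimple K H)
    (hsimple : ∀ i, (ρ i).IsSimple) (hinj : ∀ i j, (ρ i).Iso (ρ j) → i = j)
    (hcov : ∀ (W : Type u) [AddCommGroup W] [Module K W] (σ : RightCoaction K H W),
      σ.IsSimple → ∃ i, (ρ i).Iso σ) (g : H) :
    {i | (ρ i).action (integralForm φ g) ≠ 0}.Finite := by
  have hg : g ∈ ⨆ i, (ρ i).coeffSpace := by
    rw [hH.iSup_coeffSpace hcov]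
    trivial
  induction hg using Submodule.iSup_induction' with
  | mem i g hg =>
    refine (Set.finite_singleton i).subset fun j hj => ?_
    by_contra hne
    exact hj (hφ.action_integralForm_eq_zero hsimple hinj (Ne.symm hne) hg)
  | zero => simp
  | add a b _ _ ha hb =>
    refine (ha.union hb).subset fun i hi => ?_
    by_contra h
    simp only [Set.mem_union, Set.mem_ofPred_eq, not_or, not_not] at h
    exact hi (by rw [map_add, map_add, h.1, h.2, add_zero])

theorem IsLeftIntegral.exists_mem_coeffSpace [IsAlgClosed K] {φ : H →ₗ[K] K}
    (hφ : IsLeftIntegral φ) (hH : IsCosemisimple K H)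
    (hsimple : ∀ i, (ρ i).IsSimple) (hinj : ∀ i j, (ρ i).Iso (ρ j) → i = j)
    (hcov : ∀ (W : Type u) [AddCommGroup W] [Module K W] (σ : RightCoaction K H W),
      σ.IsSimple → ∃ i, (ρ i).Iso σ) (i : Λ) (T : Module.End K (V i)) :
    ∃ g ∈ (ρ i).coeffSpace, (ρ i).action (integralForm φ g) = T := by
  have := (hsimple i).finiteDimensional
  let ψ : (ρ i).coeffSpace →ₗ[K] Module.End K (V i) :=
    (ρ i).action.toLinearMap ∘ₗ integralForm φ ∘ₗ (ρ i).coeffSpace.subtype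
  -- The other components vanish on these coefficients, so a zero i-component makes the whole form
  -- zero.
  have hψ : Function.Injective ψ := by
    refine (injective_iff_map_eq_zero _).mpr fun g hg => Subtype.ext ?_
    refine (map_eq_zero_iff _ (hφ.integralForm_injective hH)).mp
      (hH.eq_zero_of_forall_action_eq_zero hcov _ fun j => ?_)
    by_cases hij : i = j
    · subst hij
      exact hg
    · exact hφ.action_integralForm_eq_zero hsimple hinj hij g.2
  have : FiniteDimensional K (ρ i).coeffSpace := FiniteDimensional.of_injective ψ hψ
  obtain ⟨g, rfl⟩ := (LinearMap.injective_iff_surjective_of_finrank_eq_finrank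
    ((LinearMap.finrank_le_finrank_of_injective hψ).antisymm
      (hsimple i).finrank_end_le)).mp hψ T
  exact ⟨g, g.2, rfl⟩

end Decomposition

end HopfConv

theorem mainTheorem4 {K : Type u} {H : Type v} [Field K] [IsAlgClosed K] [CharZero K]
    [Ring H] [HopfAlgebra K H] (hH : HopfConv.IsCosemisimple K H) :
    (∃ φ : H →ₗ[K] K, HopfConv.IsLeftIntegral φ) ∧
    ∀ φ : H →ₗ[K] K, HopfConv.IsLeftIntegral φ →
      -- `V` contains exactly one simple right comodule from each isomorphism class
      ∀ {Λ : Type w} (V : Λ → Type x) [∀ i, AddCommGroup (V i)] [∀ i, Module K (V i)]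
        (ρ : ∀ i, HopfConv.RightCoaction K H (V i)),
        (∀ i, (ρ i).IsSimple) →
        (∀ i j, (ρ i).Iso (ρ j) → i = j) →
        (∀ (W : Type u) [AddCommGroup W] [Module K W] (σ : HopfConv.RightCoaction K H W),
          σ.IsSimple → ∃ i, (ρ i).Iso σ) →
        ∃ Φ : HopfConv.ConvAlg φ →ₙₐ[K]
            HopfConv.directSumAlg K (fun i => Module.End K (V i)),
          Function.Bijective Φ := by
  refine ⟨hH.exists_isLeftIntegral, fun φ hφ Λ V _ _ ρ hsimple hinj hcov => ?_⟩
  let Ψ : H →ₗ[K] HopfConv.directSumAlg K (fun i => Module.End K (V i)) :=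
    { toFun := fun g => ⟨fun i => (ρ i).action (HopfConv.integralForm φ g),
        hφ.finite_setOf_action_integralForm_ne_zero hH hsimple hinj hcov g⟩
      map_add' := fun a b => Subtype.ext (funext fun i => by simp)
      map_smul' := fun c a => Subtype.ext (funext fun i => by simp) }
  have hΨ (g : H) (i : Λ) : (Ψ g).1 i = (ρ i).action (HopfConv.integralForm φ g) := rfl
  let Φ : HopfConv.ConvAlg φ →ₙₐ[K] HopfConv.directSumAlg K (fun i => Module.End K (V i)) :=
    { toFun := fun g => Ψ g
      map_smul' := Ψ.map_smul
      map_zero' := Ψ.map_zero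
      map_add' := Ψ.map_add
      map_mul' := fun a b => Subtype.ext (funext fun i =>
        (congrArg (ρ i).action (hφ.integralForm_conv a b)).trans (map_mul _ _ _)) }
  refine ⟨Φ, show Function.Injective Ψ from ?_, show Function.Surjective Ψ from ?_⟩
  · refine (injective_iff_map_eq_zero Ψ).mpr fun g hg => ?_
    refine (map_eq_zero_iff _ (hφ.integralForm_injective hH)).mp
      (hH.eq_zero_of_forall_action_eq_zero hcov _ fun i => ?_)
    rw [← hΨ, hg]
    rfl
  · rintro ⟨a, ha⟩
    choose g hg hga using fun i => hφ.exists_mem_coeffSpace hH hsimple hinj hcov i (a i)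
    have hfin : {i | a i ≠ 0}.Finite := ha
    -- Lift each component inside its own coefficient space; at j only the summand g j survives.
    refine ⟨∑ i ∈ hfin.toFinset, g i, Subtype.ext (funext fun j => ?_)⟩
    rw [hΨ, map_sum, map_sum, Finset.sum_eq_single j]
    · exact hga j
    · exact fun i _ hij => hφ.action_integralForm_eq_zero hsimple hinj hij (hg i)
    · intro hj
      rw [hga]
      simpa using hj
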